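/- Let $X$ be a scheme with structure sheaf $\mathcal{O}_X$. For $\mathcal{O}_X$-modules $\mathscr{M},\mathscr{N}$, let $\mathscr{M}\otimes\mathscr{N}$ denote the sheafification of the presheaf $U\mapsto \mathscr{M}(U)\otimes_{\mathcal{O}_X(U)}\mathscr{N}(U)$. A morphism $\tau:\mathscr{F}\to\mathscr{G}$ of $\mathcal{O}_X$-modules is called pure exact if it is a monomorphism and, for every $\mathcal{O}_X$-module $\mathscr{M}$ (not necessarily quasi-coherent), $\mathrm{id}\otimes\tau:\mathscr{M}\otimes\mathscr{F}\to\mathscr{M}\otimes\mathscr{G}$ is a monomorphism. A homomorphism $L\to M$ of modules over a commutative ring $R$ is called a pure monomorphism if it is injective and $T\otimes_R L\to T\otimes_R M$ is injective for every $R$-module $T$. (a) Let $\tau:\mathscr{F}\to\mathscr{G}$ be a monomorphism of $\mathcal{O}_X$-modules. Then $\tau$ is pure exact if and only if, for each $x\in X$, the stalk map $\tau_x:\mathscr{F}_x\to\mathscr{G}_x$ is a pure monomorphism of $\mathcal{O}_{X,x}$-modules. (b) Let $\tau:\mathscr{F}\to\mathscr{G}$ be a morphism of quasi-coherent $\mathcal{O}_X$-modules.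 The following are equivalent: 1. $\tau$ is pure exact; 2. there exists a covering $\{U_i\}$ of $X$ by affine open subsets such that, for each $i$, $\tau_{U_i}:\mathscr{F}(U_i)\to\mathscr{G}(U_i)$ is a pure monomorphism of $\mathcal{O}_X(U_i)$-modules; 3. for each $x\in X$, $\tau_x:\mathscr{F}_x\to\mathscr{G}_x$ is a pure monomorphism of $\mathcal{O}_{X,x}$-modules. -/

import Mathlib

open CategoryTheory MonoidalCategory AlgebraicGeometry

universe u

/-- A linear map `f : L → M` of modules over a commutative ring `R` is a pure monomorphism if it is
injective and `T ⊗ L → T ⊗ M` is injective for every `R`-module `T`. -/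
def IsPureMono {R L M : Type u} [CommRing R] [AddCommGroup L] [AddCommGroup M]
    [Module R L] [Module R M] (f : L →ₗ[R] M) : Prop :=
  Function.Injective f ∧
    ∀ (T : Type u) [AddCommGroup T] [Module R T], Function.Injective (f.lTensor T)

namespace AlgebraicGeometry.Scheme.Modules

variable {X : Scheme.{u}}

/-- The underlying presheaf of modules of an `𝒪_X`-module, over the presheaf of
commutative rings `𝒪_X`. -/
abbrev toPresh (M : X.Modules) :
    _root_.PresheafOfModules.{u} (X.presheaf ⋙ forget₂ CommRingCat RingCat) :=
  (toPresheafOfModules X).obj M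

/-- The morphism of presheaves of modules underlying a morphism of `𝒪_X`-modules. -/
abbrev toPreshMap {M N : X.Modules} (τ : M ⟶ N) : M.toPresh ⟶ N.toPresh :=
  (toPresheafOfModules X).map τ

variable (X) in
/-- The sheafification functor from presheaves of modules to `𝒪_X`-modules. -/
noncomputable def sheafification : X.PresheafOfModules ⥤ X.Modules :=
  _root_.PresheafOfModules.sheafification (𝟙 X.ringCatSheaf.obj)

/-- The tensor product of two `𝒪_X`-modules: the sheafification of
`U ↦ M(U) ⊗_{𝒪_X(U)} N(U)`. -/
noncomputable def tensor (M N : X.Modules) : X.Modules :=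
  (sheafification X).obj (M.toPresh ⊗ N.toPresh :)

/-- The map `id ⊗ τ : M ⊗ F ⟶ M ⊗ G` induced by `τ : F ⟶ G`. -/
noncomputable def tensorMap (M : X.Modules) {F G : X.Modules} (τ : F ⟶ G) :
    tensor M F ⟶ tensor M G :=
  (sheafification X).map (M.toPresh ◁ toPreshMap τ :)

/-- A morphism `τ : F ⟶ G` of `𝒪_X`-modules such that `0 ⟶ F ⟶ G` is pure exact: `τ` is a
monomorphism, and it stays one after tensoring with every `𝒪_X`-module. -/
def IsPureExact {F G : X.Modules} (τ : F ⟶ G) : Prop :=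
  Mono τ ∧ ∀ M : X.Modules, Mono (tensorMap M τ)

/-- The `𝒪_X(U)`-linear map `F(U) → G(U)` given by `τ : F ⟶ G`. -/
noncomputable def appLinear {F G : X.Modules} (τ : F ⟶ G) (U : X.Opens) :
    Γ(F, U) →ₗ[Γ(X, U)] Γ(G, U) :=
  { (τ.app U).hom with map_smul' := fun r s => Hom.app_smul τ r s }

/-- The `𝒪_{X,x}`-module structure on the stalk `M_x`. -/
noncomputable instance stalkModule (M : X.Modules) (x : X) :
    Module (X.presheaf.stalk x) (M.presheaf.stalk x) :=
  inferInstanceAs (Module (X.presheaf.stalk x) ↑(TopCat.Presheaf.stalk M.toPresh.presheaf x))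

/-- The module structure on the stalk is compatible with germs. -/
lemma germ_smul' (M : X.Modules) (x : X) (U : X.Opens) (hx : x ∈ U) (r : Γ(X, U)) (m : Γ(M, U)) :
    M.presheaf.germ U x hx (r • m) = X.presheaf.germ U x hx r • M.presheaf.germ U x hx m :=
  _root_.PresheafOfModules.germ_smul (R := X.presheaf) M.toPresh x U hx r m

/-- The `𝒪_{X,x}`-linear map of stalks `F_x → G_x` induced by `τ : F ⟶ G`. -/
noncomputable def stalkLinear {F G : X.Modules} (τ : F ⟶ G) (x : X) :
    F.presheaf.stalk x →ₗ[X.presheaf.stalk x] G.presheaf.stalk x :=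
  { ((TopCat.Presheaf.stalkFunctor Ab x).map τ.mapPresheaf).hom with
    map_smul' := by
      intro r m
      obtain ⟨V, hV, r, rfl⟩ := X.presheaf.exists_germ_eq r
      obtain ⟨U, hUV, hU, m, rfl⟩ := F.presheaf.exists_le_germ_eq m hV
      have hr : X.presheaf.germ V x hV r =
          X.presheaf.germ U x hU (X.presheaf.map (homOfLE hUV).op r) :=
        (X.presheaf.germ_res_apply (homOfLE hUV) x hU r).symm
      have key : ∀ s : Γ(F, U), (TopCat.Presheaf.stalkFunctor Ab x).map τ.mapPresheaf
          (F.presheaf.germ U x hU s) = G.presheaf.germ U x hU (τ.app U s) :=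
        fun s => TopCat.Presheaf.stalkFunctor_map_germ_apply U x hU τ.mapPresheaf s
      rw [hr, ← germ_smul']
      refine (key _).trans ?_
      rw [Hom.app_smul, germ_smul']
      exact congrArg _ (key _).symm }

end AlgebraicGeometry.Scheme.Modules

/-! ### Monomorphisms and sheafification on stalks. -/

open CategoryTheory MonoidalCategory AlgebraicGeometry
open TopologicalSpace Opposite TensorProduct

/-! Everything reduces to stalks. A morphism of sheaves is mono iff it is injective on stalks,
sheafification does not change stalks, and stalks commute with tensor products
(`stalkTensor_bijective`). So `id ⊗ τ` is mono iff every `M_x ⊗ τ_x` is injective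
(`mono_tensorMap_iff`), and purity on stalks gives pure exactness. Conversely, every
`𝒪_{X,x}`-module is the stalk at `x` of a skyscraper module (`skyscraperStalkEquiv`); here it
matters that the test modules need not be quasi-coherent.

For quasi-coherent modules, the stalk at a point of an affine open `U` is the localization of the
sections over `U` at the corresponding prime (`isLocalizedModule_germLinear`). Purity passes to
localizations (`IsPureMono.of_isLocalizedModule`). It also descends from them: an element of the
kernel of `F(U) ⊗ T → G(U) ⊗ T` dies in the localization at every prime, hence is zero. -/

/-- Sheafification of abelian presheaves preserves and reflects injectivity on stalks. -/
lemma TopCat.Presheaf.stalkFunctor_map_sheafifyMap_injective_iff {X : TopCat.{u}}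
    {A B : X.Presheaf Ab.{u}} (f : A ⟶ B) (x : X) :
    Function.Injective ((stalkFunctor Ab x).map
      (sheafifyMap (Opens.grothendieckTopology X) f)) ↔
      Function.Injective ((stalkFunctor Ab x).map f) := by
  have hA : IsIso ((stalkFunctor Ab x).map
      (CategoryTheory.toSheafify (Opens.grothendieckTopology X) A)) :=
    stalkFunctor_map_unit_toSheafify_isIso x Ab A
  have hB : IsIso ((stalkFunctor Ab x).map
      (CategoryTheory.toSheafify (Opens.grothendieckTopology X) B)) :=
    stalkFunctor_map_unit_toSheafify_isIso x Ab B
  have nat := congrArg (stalkFunctor Ab x).map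
    (toSheafify_naturality (Opens.grothendieckTopology X) f)
  rw [Functor.map_comp, Functor.map_comp] at nat
  have hA' := ConcreteCategory.bijective_of_isIso ((stalkFunctor Ab x).map
    (CategoryTheory.toSheafify (Opens.grothendieckTopology X) A))
  have hB' := ConcreteCategory.bijective_of_isIso ((stalkFunctor Ab x).map
    (CategoryTheory.toSheafify (Opens.grothendieckTopology X) B))
  have h := congrArg (fun g => (ConcreteCategory.hom g : _ → _)) nat
  simp only [AddCommGrpCat.hom_comp, AddMonoidHom.coe_comp] at h
  rw [← Function.Injective.of_comp_iff' _ hA', ← hB'.1.of_comp_iff]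
  exact (congrArg Function.Injective h).to_iff.symm

namespace AlgebraicGeometry.Scheme.Modules

variable {X : Scheme.{u}}

/-- A morphism of `𝒪_X`-modules is a monomorphism iff it is injective on all stalks. -/
lemma mono_iff_stalkFunctor_map_injective {F G : X.Modules} (τ : F ⟶ G) :
    Mono τ ↔
      ∀ x : X, Function.Injective ((TopCat.Presheaf.stalkFunctor Ab x).map τ.mapPresheaf) := by
  -- The passage from stalks to sections needs only the source to be a sheaf.
  let F' : TopCat.Sheaf Ab X := ⟨F.presheaf, F.isSheaf⟩
  have key := TopCat.Presheaf.app_injective_iff_stalkFunctor_map_injective (F := F')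
    (G := G.presheaf) τ.mapPresheaf
  rw [← (toPresheaf X).mono_map_iff_mono, NatTrans.mono_iff_mono_app, key]
  simp only [Opposite.op_surjective.forall, AddCommGrpCat.mono_iff_injective]
  rfl

lemma mono_iff_stalkLinear_injective {F G : X.Modules} (τ : F ⟶ G) :
    Mono τ ↔ ∀ x : X, Function.Injective (stalkLinear τ x) :=
  mono_iff_stalkFunctor_map_injective τ

/-- The sheafification of a morphism of presheaves of modules is a monomorphism iff the morphism is
injective on all stalks. -/
lemma mono_sheafification_map_iff {P Q : X.PresheafOfModules} (φ : P ⟶ Q) :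
    Mono ((sheafification X).map φ) ↔
      ∀ x : X, Function.Injective ((TopCat.Presheaf.stalkFunctor Ab x).map
        ((_root_.PresheafOfModules.toPresheaf _).map φ)) := by
  rw [mono_iff_stalkFunctor_map_injective]
  -- The abelian presheaf underlying the sheafified module is, definitionally, the abelian
  -- sheafification.
  exact forall_congr' fun x => TopCat.Presheaf.stalkFunctor_map_sheafifyMap_injective_iff
    ((_root_.PresheafOfModules.toPresheaf _).map φ) x

/-! ### Stalks of the presheaf tensor product. -/

/-- The presheaf `U ↦ M(U) ⊗ F(U)` of abelian groups. -/
noncomputable abbrev tensorPresheaf (M F : X.Modules) : TopCat.Presheaf Ab X :=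
  (M.toPresh ⊗ F.toPresh :).presheaf

/-- The section `m ⊗ n` of the presheaf tensor product. -/
noncomputable def tmulSection {M F : X.Modules} {U : X.Opens} (m : Γ(M, U)) (n : Γ(F, U)) :
    (tensorPresheaf M F).obj (op U) :=
  (m ⊗ₜ[Γ(X, U)] n : Γ(M, U) ⊗[Γ(X, U)] Γ(F, U))

variable {M F : X.Modules}

lemma map_tmulSection {U V : X.Opens} (i : V ⟶ U) (m : Γ(M, U)) (n : Γ(F, U)) :
    (tensorPresheaf M F).map i.op (tmulSection m n) =
      tmulSection (M.presheaf.map i.op m) (F.presheaf.map i.op n) := rfl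

lemma tmulSection_add {U : X.Opens} (m : Γ(M, U)) (n n' : Γ(F, U)) :
    tmulSection m (n + n') = tmulSection m n + tmulSection m n' :=
  TensorProduct.tmul_add _ _ _

lemma add_tmulSection {U : X.Opens} (m m' : Γ(M, U)) (n : Γ(F, U)) :
    tmulSection (m + m') n = tmulSection m n + tmulSection m' n :=
  TensorProduct.add_tmul _ _ _

lemma smul_tmulSection {U : X.Opens} (r : Γ(X, U)) (m : Γ(M, U)) (n : Γ(F, U)) :
    tmulSection (r • m) n = tmulSection m (r • n) :=
  TensorProduct.smul_tmul _ _ _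

/-- Sections of the presheaf tensor product are generated by pure tensors. -/
lemma tensorPresheaf_induction {U : X.Opens} {p : (tensorPresheaf M F).obj (op U) → Prop}
    (tmul : ∀ m n, p (tmulSection m n)) (add : ∀ s t, p s → p t → p (s + t)) (t) : p t :=
  TensorProduct.induction_on (motive := p) (show Γ(M, U) ⊗[Γ(X, U)] Γ(F, U) from t)
    -- Zero is the pure tensor `0 ⊗ 0`, so the induction principle needs no zero case.
    ((TensorProduct.tmul_zero (R := Γ(X, U)) Γ(F, U) (0 : Γ(M, U))) ▸ tmul 0 0) tmul add

variable (M) in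
/-- The map of abelian presheaves underlying `id ⊗ τ`. -/
noncomputable abbrev tensorPresheafMap {G : X.Modules} (τ : F ⟶ G) :
    tensorPresheaf M F ⟶ tensorPresheaf M G :=
  (_root_.PresheafOfModules.toPresheaf _).map (M.toPresh ◁ toPreshMap τ :)

lemma tensorPresheafMap_tmulSection {G : X.Modules} (τ : F ⟶ G) {U : X.Opens} (m : Γ(M, U))
    (n : Γ(F, U)) : (tensorPresheafMap M τ).app (op U) (tmulSection m n) =
      tmulSection m (τ.app U n) := rfl

section

variable (M F) (x : X)

/-- The map `M(U) ⊗ F(U) → M_x ⊗ F_x` for `x ∈ U`. -/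
noncomputable def germTensor (U : X.Opens) (hx : x ∈ U) :
    (tensorPresheaf M F).obj (op U) ⟶
      AddCommGrpCat.of (M.presheaf.stalk x ⊗[X.presheaf.stalk x] F.presheaf.stalk x) :=
  AddCommGrpCat.ofHom
    (TensorProduct.liftAddHom (R := Γ(X, U)) (M := Γ(M, U)) (N := Γ(F, U))
      (AddMonoidHom.mk' (fun m => AddMonoidHom.mk'
        (fun n => M.presheaf.germ U x hx m ⊗ₜ F.presheaf.germ U x hx n)
        (fun n n' => by rw [map_add, TensorProduct.tmul_add]))
        (fun m m' => by ext n; simp [TensorProduct.add_tmul]))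
      (fun r m n => by
        change M.presheaf.germ U x hx (r • m) ⊗ₜ[X.presheaf.stalk x] F.presheaf.germ U x hx n =
          M.presheaf.germ U x hx m ⊗ₜ[X.presheaf.stalk x] F.presheaf.germ U x hx (r • n)
        rw [germ_smul', germ_smul', TensorProduct.smul_tmul]) :
      Γ(M, U) ⊗[Γ(X, U)] Γ(F, U) →+
        (M.presheaf.stalk x ⊗[X.presheaf.stalk x] F.presheaf.stalk x))

@[simp]
lemma germTensor_tmulSection (U : X.Opens) (hx : x ∈ U) (m : Γ(M, U)) (n : Γ(F, U)) :
    germTensor M F x U hx (tmulSection m n) =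
      M.presheaf.germ U x hx m ⊗ₜ F.presheaf.germ U x hx n := rfl

lemma germTensor_res {U V : X.Opens} (i : V ⟶ U) (hx : x ∈ V) :
    (tensorPresheaf M F).map i.op ≫ germTensor M F x V hx = germTensor M F x U (i.le hx) := by
  ext t
  induction t using tensorPresheaf_induction with
  | add s t hs ht => rw [map_add, map_add, hs, ht]
  | tmul m n =>
    rw [ConcreteCategory.comp_apply, map_tmulSection, germTensor_tmulSection,
      germTensor_tmulSection, TopCat.Presheaf.germ_res_apply, TopCat.Presheaf.germ_res_apply]

/-- The comparison map `(M ⊗ F)_x → M_x ⊗ F_x`. -/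
noncomputable def stalkTensor :
    (tensorPresheaf M F).stalk x ⟶
      AddCommGrpCat.of (M.presheaf.stalk x ⊗[X.presheaf.stalk x] F.presheaf.stalk x) :=
  Limits.colimit.desc ((OpenNhds.inclusion x).op ⋙ tensorPresheaf M F)
    { pt := _
      ι :=
        { app := fun U => germTensor M F x U.unop.1 U.unop.2
          naturality := fun _ V i =>
            (germTensor_res M F x (homOfLE i.unop.le) V.unop.2).trans
              (Category.comp_id _).symm } }

lemma stalkTensor_germ (U : X.Opens) (hx : x ∈ U) (t : (tensorPresheaf M F).obj (op U)) :
    stalkTensor M F x ((tensorPresheaf M F).germ U x hx t) = germTensor M F x U hx t :=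
  ConcreteCategory.congr_hom (Limits.colimit.ι_desc
    (F := (OpenNhds.inclusion x).op ⋙ tensorPresheaf M F) _ (op (⟨U, hx⟩ : OpenNhds x))) t

lemma exists_common_germ (m : M.presheaf.stalk x) (n : F.presheaf.stalk x) {V : X.Opens}
    (hV : x ∈ V) :
    ∃ U ≤ V, ∃ (hU : x ∈ U) (m' : Γ(M, U)) (n' : Γ(F, U)),
      M.presheaf.germ U x hU m' = m ∧ F.presheaf.germ U x hU n' = n := by
  obtain ⟨W, hWV, hW, m', rfl⟩ := M.presheaf.exists_le_germ_eq m hV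
  obtain ⟨U, hUW, hU, n', rfl⟩ := F.presheaf.exists_le_germ_eq n hW
  exact ⟨U, hUW.trans hWV, hU, M.presheaf.map (homOfLE hUW).op m', n',
    M.presheaf.germ_res_apply _ _ _ _, rfl⟩

-- Independence of representatives: this is what makes `stalkTmul`, defined by arbitrary choices,
-- computable on any pair of germs.
variable {M F x} in
lemma germ_tmulSection_congr {U V : X.Opens} (hU : x ∈ U) (hV : x ∈ V) (m : Γ(M, U)) (n : Γ(F, U))
    (m' : Γ(M, V)) (n' : Γ(F, V)) (hm : M.presheaf.germ U x hU m = M.presheaf.germ V x hV m')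
    (hn : F.presheaf.germ U x hU n = F.presheaf.germ V x hV n') :
    (tensorPresheaf M F).germ U x hU (tmulSection m n) =
      (tensorPresheaf M F).germ V x hV (tmulSection m' n') := by
  obtain ⟨W, hW, i, j, h⟩ := M.presheaf.germ_eq x hU hV m m' hm
  obtain ⟨W', hW', i', j', h'⟩ := F.presheaf.germ_eq x hU hV n n' hn
  refine (tensorPresheaf M F).germ_ext (W ⊓ W') ⟨hW, hW'⟩ (Opens.infLELeft W W' ≫ i)
    (Opens.infLELeft W W' ≫ j) ?_
  -- The two germ equalities are witnessed on different neighbourhoods. On their intersection the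
  -- restriction paths agree, as inclusions of opens are unique.
  have e : Opens.infLELeft W W' ≫ i = Opens.infLERight W W' ≫ i' := rfl
  have e' : Opens.infLELeft W W' ≫ j = Opens.infLERight W W' ≫ j' := rfl
  have h₁ := congrArg (M.presheaf.map (Opens.infLELeft W W').op) h
  have h₂ := congrArg (F.presheaf.map (Opens.infLERight W W').op) h'
  rw [← ConcreteCategory.comp_apply, ← ConcreteCategory.comp_apply, ← Functor.map_comp,
    ← Functor.map_comp, ← op_comp, ← op_comp] at h₁ h₂
  rw [map_tmulSection, map_tmulSection, h₁, e, e', h₂]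

/-- The bilinear map `M_x × F_x → (M ⊗ F)_x`, as a function. -/
noncomputable def stalkTmul (m : M.presheaf.stalk x) (n : F.presheaf.stalk x) :
    (tensorPresheaf M F).stalk x :=
  have h := exists_common_germ M F x m n (V := ⊤) trivial
  (tensorPresheaf M F).germ h.choose x h.choose_spec.2.choose
    (tmulSection h.choose_spec.2.choose_spec.choose
      h.choose_spec.2.choose_spec.choose_spec.choose)

variable {M F x} in
lemma stalkTmul_germ {U : X.Opens} (hU : x ∈ U) (m : Γ(M, U)) (n : Γ(F, U)) :
    stalkTmul M F x (M.presheaf.germ U x hU m) (F.presheaf.germ U x hU n) =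
      (tensorPresheaf M F).germ U x hU (tmulSection m n) := by
  have h := exists_common_germ M F x (M.presheaf.germ U x hU m) (F.presheaf.germ U x hU n)
    (V := ⊤) trivial
  have h' := h.choose_spec.2.choose_spec.choose_spec.choose_spec
  exact germ_tmulSection_congr _ _ _ _ _ _ h'.1 h'.2

/-- The comparison map `M_x ⊗ F_x → (M ⊗ F)_x`. -/
noncomputable def tensorStalk :
    M.presheaf.stalk x ⊗[X.presheaf.stalk x] F.presheaf.stalk x →+
      (tensorPresheaf M F).stalk x :=
  TensorProduct.liftAddHom
    (AddMonoidHom.mk' (fun m => AddMonoidHom.mk' (fun n => stalkTmul M F x m n) (fun n n' => by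
        obtain ⟨V, -, hV, m, n, rfl, rfl⟩ := exists_common_germ M F x m n (V := ⊤) trivial
        obtain ⟨U, hUV, hU, n', rfl⟩ := F.presheaf.exists_le_germ_eq n' hV
        rw [← M.presheaf.germ_res_apply (homOfLE hUV) x hU,
          ← F.presheaf.germ_res_apply (homOfLE hUV) x hU, ← map_add, stalkTmul_germ,
          stalkTmul_germ, stalkTmul_germ, ← map_add, tmulSection_add]))
      (fun m m' => by
        ext n
        change stalkTmul M F x (m + m') n = stalkTmul M F x m n + stalkTmul M F x m' n
        obtain ⟨V, -, hV, m, n, rfl, rfl⟩ := exists_common_germ M F x m n (V := ⊤) trivial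
        obtain ⟨U, hUV, hU, m', rfl⟩ := M.presheaf.exists_le_germ_eq m' hV
        rw [← M.presheaf.germ_res_apply (homOfLE hUV) x hU,
          ← F.presheaf.germ_res_apply (homOfLE hUV) x hU, ← map_add, stalkTmul_germ,
          stalkTmul_germ, stalkTmul_germ, ← map_add, add_tmulSection]))
    (fun r m n => by
        change stalkTmul M F x (r • m) n = stalkTmul M F x m (r • n)
        -- The scalar is represented first, so that `m` and `n` can be represented inside its
        -- domain.
        obtain ⟨V, hV, r, rfl⟩ := X.presheaf.exists_germ_eq r
        obtain ⟨U, hUV, hU, m, n, rfl, rfl⟩ := exists_common_germ M F x m n hV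
        rw [← X.presheaf.germ_res_apply (homOfLE hUV) x hU, ← germ_smul', ← germ_smul',
          stalkTmul_germ, stalkTmul_germ, smul_tmulSection])

lemma tensorStalk_germTensor (U : X.Opens) (hx : x ∈ U) (t : (tensorPresheaf M F).obj (op U)) :
    tensorStalk M F x (germTensor M F x U hx t) = (tensorPresheaf M F).germ U x hx t := by
  induction t using tensorPresheaf_induction with
  | add s t hs ht => rw [map_add, map_add, map_add, hs, ht]
  | tmul m n => exact stalkTmul_germ hx m n

/-- `tensorStalk` is a left inverse, which gives injectivity. Surjectivity is checked on pure
tensors, where both germs are represented over one neighbourhood. -/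
lemma stalkTensor_bijective : Function.Bijective (stalkTensor M F x) := by
  refine ⟨Function.LeftInverse.injective (g := tensorStalk M F x) fun t => ?_, fun t => ?_⟩
  · obtain ⟨U, hU, t, rfl⟩ := (tensorPresheaf M F).exists_germ_eq t
    rw [stalkTensor_germ, tensorStalk_germTensor]
  · change ∃ s, stalkTensor M F x s = t
    induction t using TensorProduct.induction_on with
    | zero => exact ⟨0, map_zero _⟩
    | add s t hs ht =>
      obtain ⟨s, rfl⟩ := hs
      obtain ⟨t, rfl⟩ := ht
      exact ⟨s + t, map_add _ _ _⟩
    | tmul m n =>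
      obtain ⟨U, -, hU, m, n, rfl, rfl⟩ := exists_common_germ M F x m n (V := ⊤) trivial
      exact ⟨(tensorPresheaf M F).germ U x hU (tmulSection m n), stalkTensor_germ M F x U hU _⟩

variable {F} in
lemma stalkTensor_naturality {G : X.Modules} (τ : F ⟶ G) (t : (tensorPresheaf M F).stalk x) :
    stalkTensor M G x ((TopCat.Presheaf.stalkFunctor Ab x).map (tensorPresheafMap M τ) t) =
      (stalkLinear τ x).lTensor (M.presheaf.stalk x) (stalkTensor M F x t) := by
  obtain ⟨U, hU, t, rfl⟩ := (tensorPresheaf M F).exists_germ_eq t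
  refine (congrArg _ (TopCat.Presheaf.stalkFunctor_map_germ_apply U x hU
    (tensorPresheafMap M τ) t)).trans ?_
  rw [stalkTensor_germ, stalkTensor_germ]
  induction t using tensorPresheaf_induction with
  | add s t hs ht =>
    rw [map_add, map_add, map_add, hs, ht]
    exact (map_add ((stalkLinear τ x).lTensor (M.presheaf.stalk x)) _ _).symm
  | tmul m n =>
    rw [tensorPresheafMap_tmulSection, germTensor_tmulSection, germTensor_tmulSection,
      LinearMap.lTensor_tmul]
    exact congrArg _
     (TopCat.Presheaf.stalkFunctor_map_germ_apply U x hU τ.mapPresheaf n).symm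

variable {F} in
/-- `id ⊗ τ : M ⊗ F ⟶ M ⊗ G` is a monomorphism iff `M_x ⊗ F_x → M_x ⊗ G_x` is injective for
all points `x`. -/
theorem mono_tensorMap_iff {G : X.Modules} (τ : F ⟶ G) :
    Mono (tensorMap M τ) ↔
      ∀ x : X, Function.Injective ((stalkLinear τ x).lTensor (M.presheaf.stalk x)) := by
  refine (mono_sheafification_map_iff _).trans (forall_congr' fun x => ?_)
  change Function.Injective ((TopCat.Presheaf.stalkFunctor Ab x).map (tensorPresheafMap M τ)) ↔ _
  rw [← Function.Injective.of_comp_iff' _ (stalkTensor_bijective M F x)]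
  refine ((stalkTensor_bijective M G x).1.of_comp_iff _).symm.trans ?_
  exact (congrArg Function.Injective (funext (stalkTensor_naturality M x τ))).to_iff

end

end AlgebraicGeometry.Scheme.Modules

namespace AlgebraicGeometry.Scheme.Modules

variable {X : Scheme.{u}}

/-! ### Skyscraper modules and the stalk criterion for arbitrary modules. -/

section Skyscraper

variable (x : X) (T : Type u) [AddCommGroup T]

/-- The skyscraper presheaf of abelian groups at `x` with value `T`: its sections over `U` are the
functions to `T` from the proofs that `x ∈ U`. -/
def skyscraperAb : TopCat.Presheaf Ab.{u} X where
  obj U := AddCommGrpCat.of (PLift (x ∈ U.unop) → T)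
  map i := AddCommGrpCat.ofHom
    { toFun := fun s h => s ⟨i.unop.le h.down⟩
      map_zero' := rfl
      map_add' := fun _ _ => rfl }

/-- A compatible family takes the same value on all members containing `x`, so the gluing reads it
off from any one of them. If no member contains `x`, the sections over the union are trivial. -/
lemma skyscraperAb_isSheaf : (skyscraperAb x T).IsSheaf := by
  refine (TopCat.Presheaf.isSheaf_iff_isSheafUniqueGluing _).2 fun ι U s hs => ?_
  change ∀ i, PLift (x ∈ U i) → T at s
  have hs' : ∀ i j (hi : x ∈ U i) (hj : x ∈ U j), s i ⟨hi⟩ = s j ⟨hj⟩ := fun i j hi hj =>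
    congrFun (hs i j) ⟨⟨hi, hj⟩⟩
  have hmem : ∀ h : PLift (x ∈ iSup U), ∃ i, x ∈ U i := fun h => Opens.mem_iSup.1 h.down
  refine ⟨fun h => s (hmem h).choose ⟨(hmem h).choose_spec⟩, fun i => ?_, fun t ht => ?_⟩
  · funext h
    exact hs' _ _ _ _
  · funext h
    exact congrFun (ht (hmem h).choose) ⟨(hmem h).choose_spec⟩

variable [Module (X.presheaf.stalk x) T]

/-- Scalars act through their germ at `x`, which exists only given a proof of `x ∈ U`. The module
structure on `T` thus varies with that proof, hence the explicit `Pi.module`. -/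
noncomputable instance skyscraperAbModule (U : (X.Opens)ᵒᵖ) :
    Module (X.ringCatSheaf.obj.obj U) ((skyscraperAb x T).obj U) :=
  @Pi.module (PLift (x ∈ U.unop)) (fun _ => T) (Γ(X, U.unop)) _ _
    (fun h => Module.compHom T (X.presheaf.germ U.unop x h.down).hom)

/-- The skyscraper `𝒪_X`-module at `x` with value the `𝒪_{X,x}`-module `T`. -/
noncomputable def skyscraper : X.Modules where
  val := _root_.PresheafOfModules.ofPresheaf (skyscraperAb x T) (by
    intro U V i r s
    funext h
    exact congrArg (· • (show PLift (x ∈ U.unop) → T from s) ⟨i.unop.le h.down⟩)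
      (X.presheaf.germ_res_apply i.unop x h.down r).symm)
  isSheaf := skyscraperAb_isSheaf x T

/-- The stalk at `x` of the skyscraper module. -/
noncomputable def skyscraperStalkEquiv :
    T ≃ₗ[X.presheaf.stalk x] (skyscraper x T).presheaf.stalk x :=
  LinearEquiv.ofBijective
    { toFun := fun t => (skyscraper x T).presheaf.germ ⊤ x trivial (fun _ => t)
      map_add' := fun s t => map_add ((skyscraper x T).presheaf.germ ⊤ x trivial).hom _ _
      map_smul' := by
        intro r t
        obtain ⟨U, hU, r, rfl⟩ := X.presheaf.exists_germ_eq r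
        refine Eq.trans ?_ (congrArg (X.presheaf.germ U x hU r • ·)
          ((skyscraper x T).presheaf.germ_res_apply (homOfLE le_top) x hU _))
        refine Eq.trans ?_ (germ_smul' _ _ _ _ _ _)
        exact (skyscraper x T).presheaf.germ_ext U hU (homOfLE le_top) (𝟙 U) (by
          rw [op_id, CategoryTheory.Functor.map_id]; rfl) }
    ⟨by
      intro s t h
      obtain ⟨W, hW, i, j, h⟩ := (skyscraper x T).presheaf.germ_eq x _ _ _ _ h
      -- Constant sections with equal germs agree on some `W` containing `x`; evaluate there.
      exact congrFun h ⟨hW⟩, by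
      intro t
      obtain ⟨U, hU, s, rfl⟩ := (skyscraper x T).presheaf.exists_germ_eq t
      exact ⟨(show PLift (x ∈ U) → T from s) ⟨hU⟩, (skyscraper x T).presheaf.germ_ext U hU
        (homOfLE le_top) (𝟙 U) rfl⟩⟩

end Skyscraper

/-- A monomorphism of `𝒪_X`-modules is pure exact iff it is pure on all stalks. -/
theorem isPureExact_iff_stalkLinear {F G : X.Modules} (τ : F ⟶ G) :
    IsPureExact τ ↔ ∀ x : X, IsPureMono (stalkLinear τ x) := by
  refine ⟨fun ⟨h₁, h₂⟩ x => ⟨(mono_iff_stalkLinear_injective τ).1 h₁ x, fun T _ _ => ?_⟩,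
    fun h => ⟨(mono_iff_stalkLinear_injective τ).2 fun x => (h x).1, fun M =>
      (mono_tensorMap_iff M τ).2 fun x => (h x).2 _⟩⟩
  -- Testing against the skyscraper realizes `T` as a stalk at `x`; the rest transports injectivity
  -- along `T ≃ (skyscraper x T)_x`.
  have h := (mono_tensorMap_iff (skyscraper x T) τ).1 (h₂ _) x
  let e := skyscraperStalkEquiv x T
  have comm : (e.rTensor (G.presheaf.stalk x) : _ → _) ∘ (stalkLinear τ x).lTensor T =
      (stalkLinear τ x).lTensor ((skyscraper x T).presheaf.stalk x) ∘
        (e.rTensor (F.presheaf.stalk x) : _ → _) := by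
    funext t
    exact DFunLike.congr_fun ((LinearMap.rTensor_comp_lTensor _ _ _).trans
      (LinearMap.lTensor_comp_rTensor _ _ _).symm) t
  refine Function.Injective.of_comp (f := e.rTensor (G.presheaf.stalk x)) ?_
  rw [comm]
  exact h.comp (e.rTensor _).injective

end AlgebraicGeometry.Scheme.Modules

/-! ### Purity and localization of modules. -/

section Algebra

variable {R A L M L' M' : Type u} [CommRing R] [CommRing A] [Algebra R A]
  [AddCommGroup L] [Module R L] [AddCommGroup M] [Module R M]
  [AddCommGroup L'] [Module R L'] [Module A L'] [IsScalarTower R A L']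
  [AddCommGroup M'] [Module R M'] [Module A M'] [IsScalarTower R A M']

/-- Universal injectivity already contains injectivity. -/
lemma isPureMono_iff_rTensor_injective (f : L →ₗ[R] M) :
    IsPureMono f ↔
      ∀ (T : Type u) [AddCommGroup T] [Module R T], Function.Injective (f.rTensor T) := by
  refine ⟨fun h T _ _ => (LinearMap.lTensor_inj_iff_rTensor_inj T f).1 (h.2 T), fun h =>
    ⟨?_, fun T _ _ => (LinearMap.lTensor_inj_iff_rTensor_inj T f).2 (h T)⟩⟩
  -- Injectivity of `f` itself is the case `T = R`.
  have comm : (TensorProduct.rid R M : _ → _) ∘ f.rTensor R =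
      f ∘ (TensorProduct.rid R L : _ → _) := by
    funext t
    exact DFunLike.congr_fun (show (TensorProduct.rid R M).toLinearMap ∘ₗ f.rTensor R =
      f ∘ₗ (TensorProduct.rid R L).toLinearMap by ext; simp) t
  have := (TensorProduct.rid R M).injective.comp (h R)
  rw [comm] at this
  exact (Function.Injective.of_comp_iff' f (TensorProduct.rid R L).bijective).1 this

variable (S : Submonoid R) (f : L →ₗ[R] M) (f' : L' →ₗ[A] M')
  (l : L →ₗ[R] L') (m : M →ₗ[R] M')

/-- A localization of a pure monomorphism is a pure monomorphism. -/
lemma IsPureMono.of_isLocalizedModule [IsLocalization S A] [IsLocalizedModule S l]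
    [IsLocalizedModule S m] (comm : ∀ y, f' (l y) = m (f y)) (h : IsPureMono f) :
    IsPureMono f' := by
  rw [isPureMono_iff_rTensor_injective] at h ⊢
  intro T _ _
  let _ : Module R T := Module.compHom T (algebraMap R A)
  have : IsScalarTower R A T := IsScalarTower.of_compHom R A T
  have hl : IsLocalizedModule S (l.rTensor T) := IsLocalizedModule.rTensor R S l
  have hm : IsLocalizedModule S (m.rTensor T) := IsLocalizedModule.rTensor R S m
  have key : IsLocalizedModule.map S (l.rTensor T) (m.rTensor T) (f.rTensor T) =
      (f'.restrictScalars R).rTensor T := by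
    apply IsLocalizedModule.linearMap_ext S (l.rTensor T) (m.rTensor T)
    rw [IsLocalizedModule.map_comp]
    rw [← LinearMap.rTensor_comp, ← LinearMap.rTensor_comp]
    congr 1
    ext y
    exact (comm y).symm
  have inj := IsLocalizedModule.map_injective S (l.rTensor T) (m.rTensor T) _ (h T)
  rw [key] at inj
  -- Since `A` is a localization of `R`, tensoring `A`-modules over `A` or over `R` gives the same
  -- result.
  let eL := IsLocalization.moduleTensorEquiv S A L' T
  let eM := IsLocalization.moduleTensorEquiv S A M' T
  have nat : ∀ t, eM (f'.rTensor T t) = (f'.restrictScalars R).rTensor T (eL t) := by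
    intro t
    induction t using TensorProduct.induction_on with
    | zero => simp
    | add s t hs ht => simp only [map_add, hs, ht]
    | tmul a b => rfl
  intro s t hst
  apply eL.injective
  apply inj
  rw [← nat, ← nat, hst]

/-- If the localization of `f` at `S` is a pure monomorphism, then the kernel of `f ⊗ T` is
`S`-torsion for every `T`. -/
lemma IsPureMono.exists_smul_eq_zero [IsLocalizedModule S l]
    (comm : ∀ y, f' (l y) = m (f y)) (h : IsPureMono f')
    {T : Type u} [AddCommGroup T] [Module R T] (t : L ⊗[R] T) (ht : f.rTensor T t = 0) :
    ∃ s ∈ S, s • t = 0 := by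
  rw [isPureMono_iff_rTensor_injective] at h
  have hl : IsLocalizedModule S (l.rTensor T) := IsLocalizedModule.rTensor R S l
  -- Purity over `A` is used with the test module `A ⊗[R] T`, because `L' ⊗[A] (A ⊗[R] T)` is `L'
  -- ⊗[R] T`.
  let eL := TensorProduct.AlgebraTensorModule.cancelBaseChange R A A L' T
  let eM := TensorProduct.AlgebraTensorModule.cancelBaseChange R A A M' T
  have nat : ∀ t, eM (f'.rTensor (A ⊗[R] T) t) = (f'.restrictScalars R).rTensor T (eL t) := by
    intro t
    exact DFunLike.congr_fun (show eM.toLinearMap ∘ₗ f'.rTensor (A ⊗[R] T) =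
      (TensorProduct.AlgebraTensorModule.rTensor R T f') ∘ₗ eL.toLinearMap by
        ext; simp [eL, eM]) t
  have inj : Function.Injective ((f'.restrictScalars R).rTensor T) := by
    intro s t hst
    obtain ⟨s, rfl⟩ := eL.surjective s
    obtain ⟨t, rfl⟩ := eL.surjective t
    rw [← nat, ← nat] at hst
    exact congrArg eL (h _ (eM.injective hst))
  have hz : l.rTensor T t = 0 := by
    apply inj
    have e : (f'.restrictScalars R) ∘ₗ l = m ∘ₗ f := LinearMap.ext comm
    rw [map_zero, ← LinearMap.comp_apply, ← LinearMap.rTensor_comp, e, LinearMap.rTensor_comp,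
      LinearMap.comp_apply, ht, map_zero]
  obtain ⟨c, hc⟩ := (IsLocalizedModule.eq_zero_iff S (l.rTensor T)).1 hz
  exact ⟨c, c.2, hc⟩

/-- An element that is torsion with respect to the complement of every prime ideal vanishes. -/
lemma eq_zero_of_forall_prime_exists_smul_eq_zero (y : L)
    (h : ∀ p : PrimeSpectrum R, ∃ s ∈ p.asIdeal.primeCompl, s • y = 0) : y = 0 := by
  by_contra hy
  -- The colon ideal is the annihilator of `y`, proper when `y ≠ 0`. A maximal ideal above it
  -- contradicts the hypothesis at that prime.
  obtain ⟨P, hP, hle⟩ := Ideal.exists_le_maximal (Submodule.colon (⊥ : Submodule R L) {y}) (by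
    rw [Ne, Ideal.eq_top_iff_one, Submodule.mem_colon_singleton]
    simpa using hy)
  obtain ⟨s, hs, hsy⟩ := h ⟨P, hP.isPrime⟩
  exact hs (hle (by simpa [Submodule.mem_colon_singleton] using hsy))

end Algebra

namespace AlgebraicGeometry.Scheme.Modules

variable {X : Scheme.{u}}

/-! ### Sections of quasi-coherent modules over basic opens. -/

section Quasicoherent

variable (M : X.Modules) {U : X.Opens}

/-- The action of `𝒪_X(U)` on the sections of the restriction of `M` to `Spec 𝒪_X(U)`. -/
lemma smul_restrict_fromSpec (hU : IsAffineOpen U) {V : (Spec Γ(X, U)).Opens}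
    (h : hU.fromSpec ''ᵁ V ≤ U) (r : Γ(X, U)) (s : Γ(M.restrict hU.fromSpec, V)) :
    (M.restrictAppIso hU.fromSpec V).hom (r • s) =
      X.presheaf.map (homOfLE h).op r • (M.restrictAppIso hU.fromSpec V).hom s := by
  rw [smul_Spec_def]
  refine congrArg (fun c : Γ(X, hU.fromSpec ''ᵁ V) =>
    c • (M.restrictAppIso hU.fromSpec V).hom s) ?_
  have : (ΓSpecIso Γ(X, U)).inv ≫ (Spec Γ(X, U)).presheaf.map V.leTop.op ≫
      (hU.fromSpec.appIso V).inv = X.presheaf.map (homOfLE h).op := by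
    rw [← Category.assoc, Iso.comp_inv_eq, Hom.appIso_hom', Hom.map_appLE]
    rw [Hom.appLE, hU.fromSpec_app_self, Category.assoc, ← Functor.map_comp]
    rfl
  exact ConcreteCategory.congr_hom this r

variable [M.IsQuasicoherent]

/-- Sections of a quasi-coherent module over `D(f)` extend to `U` after multiplication by a power
of `f`; see `exists_pow_smul_eq_map`. -/
lemma exists_pow_smul_eq_map_of_image_eq (hU : IsAffineOpen U) (f : Γ(X, U))
    {V D : X.Opens} (hV : hU.fromSpec ''ᵁ ⊤ = V)
    (hD : hU.fromSpec ''ᵁ (PrimeSpectrum.basicOpen f) = D) (hDV : D ≤ V)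
    (hVU : V ≤ U) (s : Γ(M, D)) :
    ∃ (n : ℕ) (t : Γ(M, V)), M.presheaf.map (homOfLE hDV).op t =
      X.presheaf.map (homOfLE (hDV.trans hVU)).op (f ^ n) • s := by
  -- The image of `⊤` equals `U` only propositionally; `V` and `D` as variables avoid transporting
  -- sections along that equality.
  subst hV hD
  -- Quasi-coherence enters here: on `Spec Γ(X, U)`, restriction to `D(f)` is localization at the
  -- powers of `f`.
  have loc := (isIso_fromTildeΓ_iff_isLocalizing (M.restrict hU.fromSpec)).1 inferInstance f
  obtain ⟨⟨t, ⟨_, n, rfl⟩⟩, h⟩ := loc.surj s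
  exact ⟨n, t, h.symm.trans (smul_restrict_fromSpec M hU (hDV.trans hVU) (f ^ n) s)⟩

/-- Sections of a quasi-coherent module over `U` that vanish on `D(f)` are killed by a power
of `f`; see `exists_pow_smul_eq_zero`. -/
lemma exists_pow_smul_eq_zero_of_image_eq (hU : IsAffineOpen U) (f : Γ(X, U))
    {V D : X.Opens} (hV : hU.fromSpec ''ᵁ ⊤ = V)
    (hD : hU.fromSpec ''ᵁ (PrimeSpectrum.basicOpen f) = D) (hDV : D ≤ V)
    (hVU : V ≤ U) (t : Γ(M, V)) (ht : M.presheaf.map (homOfLE hDV).op t = 0) :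
    ∃ n : ℕ, X.presheaf.map (homOfLE hVU).op (f ^ n) • t = 0 := by
  subst hV hD
  have loc := (isIso_fromTildeΓ_iff_isLocalizing (M.restrict hU.fromSpec)).1 inferInstance f
  obtain ⟨⟨_, n, rfl⟩, hn⟩ := (IsLocalizedModule.eq_zero_iff (.powers f)
    ((modulesSpecToSheaf.obj (M.restrict hU.fromSpec)).obj.map
      (PrimeSpectrum.basicOpen f).leTop.op).hom).1 ht
  exact ⟨n, (smul_restrict_fromSpec M hU hVU (f ^ n) t).symm.trans hn⟩

/-- Sections of a quasi-coherent module over `D(f)` extend to the affine open `U` after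
multiplication by a power of `f`. -/
lemma exists_pow_smul_eq_map (hU : IsAffineOpen U) (f : Γ(X, U)) (s : Γ(M, X.basicOpen f)) :
    ∃ (n : ℕ) (t : Γ(M, U)), M.presheaf.map (homOfLE (X.basicOpen_le f)).op t =
      X.presheaf.map (homOfLE (X.basicOpen_le f)).op (f ^ n) • s :=
  exists_pow_smul_eq_map_of_image_eq M hU f (by simp) (hU.fromSpec_image_basicOpen f) _ le_rfl s

/-- Sections of a quasi-coherent module over the affine open `U` that vanish on `D(f)` are killed
by a power of `f`. -/
lemma exists_pow_smul_eq_zero (hU : IsAffineOpen U) (f : Γ(X, U)) (t : Γ(M, U))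
    (ht : M.presheaf.map (homOfLE (X.basicOpen_le f)).op t = 0) : ∃ n : ℕ, f ^ n • t = 0 := by
  obtain ⟨n, hn⟩ := exists_pow_smul_eq_zero_of_image_eq M hU f (by simp)
    (hU.fromSpec_image_basicOpen f) (X.basicOpen_le f) le_rfl t ht
  refine ⟨n, ?_⟩
  have e : X.presheaf.map (homOfLE (le_refl U)).op (f ^ n) = f ^ n :=
    ConcreteCategory.congr_hom (X.presheaf.map_id (op U)) _
  rwa [e] at hn

end Quasicoherent

/-! ### Stalks of quasi-coherent modules as localizations; transfer of purity. -/

section Stalk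

variable (M F G : X.Modules) {U : X.Opens} {x : X}

/-- The `𝒪_X(U)`-module structure on the stalk `M_x` for `x ∈ U`. -/
noncomputable abbrev sectionModuleStalk (hx : x ∈ U) : Module Γ(X, U) (M.presheaf.stalk x) :=
  Module.compHom _ (X.presheaf.germ U x hx).hom

/-- The germ map as a linear map over the sections. -/
noncomputable def germLinear (hx : x ∈ U) :
    letI := sectionModuleStalk M hx
    Γ(M, U) →ₗ[Γ(X, U)] M.presheaf.stalk x :=
  letI := sectionModuleStalk M hx
  { (M.presheaf.germ U x hx).hom with
    map_smul' := fun r m => germ_smul' M x U hx r m }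

lemma mem_primeIdealOf_primeCompl_iff (hx : x ∈ U) (hU : IsAffineOpen U) (f : Γ(X, U)) :
    f ∈ (hU.primeIdealOf ⟨x, hx⟩).asIdeal.primeCompl ↔ x ∈ X.basicOpen f := by
  have h : hU.primeIdealOf ⟨x, hx⟩ ∈ PrimeSpectrum.basicOpen f ↔
      hU.fromSpec (hU.primeIdealOf ⟨x, hx⟩) ∈ X.basicOpen f := by
    rw [← hU.fromSpec_preimage_basicOpen]; rfl
  rw [hU.fromSpec_primeIdealOf] at h
  exact h

/-- The stalk of a quasi-coherent module at a point of an affine open is the localization of the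
module of sections. -/
lemma isLocalizedModule_germLinear (hx : x ∈ U) (hU : IsAffineOpen U) [M.IsQuasicoherent] :
    letI := sectionModuleStalk M hx
    IsLocalizedModule (hU.primeIdealOf ⟨x, hx⟩).asIdeal.primeCompl (germLinear M hx) := by
  let _ := sectionModuleStalk M hx
  refine ⟨fun ⟨f, hf⟩ => ?_, fun s => ?_, fun {s t} h => ?_⟩
  -- The germ of `f` is a unit of the local ring, so it acts bijectively on the stalk.
  · rw [mem_primeIdealOf_primeCompl_iff, X.mem_basicOpen _ _ hx] at hf
    refine (Module.End.isUnit_iff _).2 ?_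
    exact (Module.End.isUnit_iff (R := X.presheaf.stalk x) _).1
      (hf.map (algebraMap (X.presheaf.stalk x)
        (Module.End (X.presheaf.stalk x) (M.presheaf.stalk x))))
  · obtain ⟨V, hV, s, rfl⟩ := M.presheaf.exists_germ_eq s
    -- Shrink to a basic open `D(f)` around `x`, where a power of `f` clears denominators.
    obtain ⟨f, hfV, hxf⟩ := hU.exists_basicOpen_le ⟨x, hV⟩ hx
    obtain ⟨n, t, ht⟩ := exists_pow_smul_eq_map M hU f (M.presheaf.map (homOfLE hfV).op s)
    refine ⟨(t, ⟨f ^ n, pow_mem ((mem_primeIdealOf_primeCompl_iff hx hU f).2 hxf) n⟩), ?_⟩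
    have := congrArg (M.presheaf.germ (X.basicOpen f) x hxf) ht
    rw [germ_smul', M.presheaf.germ_res_apply, M.presheaf.germ_res_apply,
      X.presheaf.germ_res_apply] at this
    exact this.symm
  · obtain ⟨W, hW, i, j, hst⟩ := M.presheaf.germ_eq x hx hx s t h
    obtain ⟨f, hfW, hxf⟩ := hU.exists_basicOpen_le ⟨x, hW⟩ hx
    obtain ⟨n, hn⟩ := exists_pow_smul_eq_zero M hU f (s - t) (by
      have := congrArg (M.presheaf.map (homOfLE hfW).op) hst
      rw [← ConcreteCategory.comp_apply, ← ConcreteCategory.comp_apply, ← Functor.map_comp,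
        ← Functor.map_comp] at this
      rw [map_sub, sub_eq_zero]
      exact this)
    refine ⟨⟨f ^ n, pow_mem ((mem_primeIdealOf_primeCompl_iff hx hU f).2 hxf) n⟩, ?_⟩
    rw [smul_sub, sub_eq_zero] at hn
    exact hn

variable {F G}

lemma stalkLinear_germLinear (hx : x ∈ U) (τ : F ⟶ G) (s : Γ(F, U)) :
    stalkLinear τ x (germLinear F hx s) = germLinear G hx (appLinear τ U s) :=
  TopCat.Presheaf.stalkFunctor_map_germ_apply U x hx τ.mapPresheaf s

/-- If `τ` is pure on the sections over an affine open, then it is pure on the stalks there. -/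
lemma isPureMono_stalkLinear_of_appLinear [F.IsQuasicoherent] [G.IsQuasicoherent]
    (hx : x ∈ U) (hU : IsAffineOpen U) (τ : F ⟶ G) (h : IsPureMono (appLinear τ U)) :
    IsPureMono (stalkLinear τ x) := by
  let _ := sectionModuleStalk F hx
  let _ := sectionModuleStalk G hx
  let _ : Algebra Γ(X, U) (X.presheaf.stalk x) := (X.presheaf.germ U x hx).hom.toAlgebra
  have : IsScalarTower Γ(X, U) (X.presheaf.stalk x) (F.presheaf.stalk x) := .of_compHom _ _ _
  have : IsScalarTower Γ(X, U) (X.presheaf.stalk x) (G.presheaf.stalk x) := .of_compHom _ _ _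
  have := isLocalizedModule_germLinear F hx hU
  have := isLocalizedModule_germLinear G hx hU
  have : IsLocalization (hU.primeIdealOf ⟨x, hx⟩).asIdeal.primeCompl (X.presheaf.stalk x) :=
    hU.isLocalization_stalk ⟨x, hx⟩
  exact h.of_isLocalizedModule (hU.primeIdealOf ⟨x, hx⟩).asIdeal.primeCompl (appLinear τ U)
    (stalkLinear τ x) (germLinear F hx) (germLinear G hx) (stalkLinear_germLinear hx τ)

/-- If `τ` is pure on the stalks at all points of an affine open, then it is pure on the
sections there. -/
lemma isPureMono_appLinear_of_stalkLinear [F.IsQuasicoherent]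
    (hU : IsAffineOpen U) (τ : F ⟶ G) (h : ∀ x ∈ U, IsPureMono (stalkLinear τ x)) :
    IsPureMono (appLinear τ U) := by
  rw [isPureMono_iff_rTensor_injective]
  intro T _ _
  refine (injective_iff_map_eq_zero _).2 fun t ht =>
    eq_zero_of_forall_prime_exists_smul_eq_zero (R := Γ(X, U)) t fun p => ?_
  -- Every prime of `Γ(X, U)` comes from a point of `U`, so stalkwise purity covers all primes.
  have hx : hU.fromSpec p ∈ U := hU.opensRange_fromSpec.le ⟨p, rfl⟩
  have hp : hU.primeIdealOf ⟨hU.fromSpec p, hx⟩ = p :=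
    hU.fromSpec.isOpenEmbedding.injective (hU.fromSpec_primeIdealOf _)
  let _ := sectionModuleStalk F hx
  let _ := sectionModuleStalk G hx
  let _ : Algebra Γ(X, U) (X.presheaf.stalk (hU.fromSpec p)) :=
    (X.presheaf.germ U _ hx).hom.toAlgebra
  have : IsScalarTower Γ(X, U) (X.presheaf.stalk (hU.fromSpec p))
    (F.presheaf.stalk (hU.fromSpec p)) := .of_compHom _ _ _
  have : IsScalarTower Γ(X, U) (X.presheaf.stalk (hU.fromSpec p))
    (G.presheaf.stalk (hU.fromSpec p)) := .of_compHom _ _ _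
  have := isLocalizedModule_germLinear F hx hU
  rw [hp] at this
  exact (h _ hx).exists_smul_eq_zero p.asIdeal.primeCompl (appLinear τ U) _ (germLinear F hx)
    (germLinear G hx) (stalkLinear_germLinear hx τ) t ht

end Stalk

end AlgebraicGeometry.Scheme.Modules

theorem mainTheorem7 (X : Scheme.{u}) :
    (∀ (F G : X.Modules) (τ : F ⟶ G), Mono τ →
      (Scheme.Modules.IsPureExact τ ↔
        ∀ x : X, IsPureMono (Scheme.Modules.stalkLinear τ x))) ∧
    (∀ (F G : X.Modules) (τ : F ⟶ G), F.IsQuasicoherent → G.IsQuasicoherent →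
      List.TFAE
        [Scheme.Modules.IsPureExact τ,
         ∃ 𝒰 : Set X.Opens, (∀ U ∈ 𝒰, IsAffineOpen U) ∧ sSup 𝒰 = ⊤ ∧
           ∀ U ∈ 𝒰, IsPureMono (Scheme.Modules.appLinear τ U),
         ∀ x : X, IsPureMono (Scheme.Modules.stalkLinear τ x)]) := by
  refine ⟨fun F G τ _ => Scheme.Modules.isPureExact_iff_stalkLinear τ, fun F G τ hF hG => ?_⟩
  tfae_have 1 ↔ 3 := Scheme.Modules.isPureExact_iff_stalkLinear τ
  tfae_have 2 → 3 := by
    rintro ⟨𝒰, haff, hcov, hpure⟩ x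
    obtain ⟨U, hU, hx⟩ := TopologicalSpace.Opens.mem_sSup.1 (hcov.ge (trivial : x ∈ (⊤ : X.Opens)))
    exact Scheme.Modules.isPureMono_stalkLinear_of_appLinear hx (haff U hU) τ (hpure U hU)
  -- The covering by all affine opens works.
  tfae_have 3 → 2 := fun h => ⟨{U | IsAffineOpen U}, fun U hU => hU,
    (sSup_eq_iSup' _).trans (iSup_affineOpens_eq_top X), fun U hU =>
      Scheme.Modules.isPureMono_appLinear_of_stalkLinear hU τ fun x _ => h x⟩
  tfae_finish
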